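/- Let $F$ be a field of characteristic $0$, let $A$ be a finite-dimensional central simple (associative, unital) $F$-algebra, let $\mathcal D$ be the (associative, not necessarily unital) subalgebra of $\operatorname{End}_F(A)$ generated by all inner derivations $x \mapsto ax-xa$, $a \in A$, of $A$, and let $[A,A]$ be the linear span of all commutators $xy-yx$ with $x,y\in A$. For every $T \in \operatorname{End}_F(A)$ the following statements are equivalent: (i) $T \in \mathcal D$; (ii) there exist finitely many $a_1,\dots,a_n, b_1,\dots,b_n \in A$ such that $Tx = \sum_{k} a_k x b_k$ for all $x \in A$, $\sum_k a_k b_k = 0$ and $\sum_k b_k a_k = 0$; (iii) $T(1)=0$ and $T(A) \subseteq [A,A]$. -/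

import Mathlib

/-- The (associative, not necessarily unital) subalgebra of `End_F(A)` generated by all inner
derivations `x ↦ a * x - x * a` of `A`. -/
def innerDerivationAlgebra (F A : Type*) [Field F] [Ring A] [Algebra F A] :
    NonUnitalSubalgebra F (Module.End F A) :=
  NonUnitalAlgebra.adjoin F
    (Set.range fun a : A => LinearMap.mulLeft F a - LinearMap.mulRight F a)

/-- The subspace `[A, A]`: the linear span of all commutators `x * y - y * x`. -/
def commutatorSubspace (F A : Type*) [Field F] [Ring A] [Algebra F A] : Submodule F A :=
  Submodule.span F {z : A | ∃ x y : A, z = x * y - y * x}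

/-! The hard implication is (iii) to (i), by Jacobson density. Let `A` be a module over the unital
algebra generated by the inner derivations. Its submodules are Lie ideals; by Herstein's dichotomy
and the splitting of `A` into scalars plus `[A, A]`, this module is semisimple. A biderivation
argument shows that its endomorphisms are `x ↦ c • x + g x` with `g` scalar-valued and zero on `[A,
A]`. The conditions in (iii) are just what makes `T` commute with these, so density puts `T` in the
unital algebra, and `T 1 = 0` removes the scalar part. -/

section SimpleRing

variable {A : Type*} [Ring A] [IsSimpleRing A]

/-- In a simple ring, an additive subgroup containing all `a * w * b` for a fixed `w ≠ 0` is
everything. -/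
theorem AddSubgroup.mem_of_mul_mul_mem (S : AddSubgroup A) {w : A} (hw : w ≠ 0)
    (h : ∀ a b, a * w * b ∈ S) (x : A) : x ∈ S := by
  let I : TwoSidedIdeal A := .mk' {x | ∀ a b, a * x * b ∈ S}
    (fun a b => by simp [S.zero_mem])
    (fun {x y} hx hy a b => by rw [mul_add, add_mul]; exact S.add_mem (hx a b) (hy a b))
    (fun {x} hx a b => by rw [mul_neg, neg_mul]; exact S.neg_mem (hx a b))
    (fun {x y} hy a b => by rw [← mul_assoc]; exact hy (a * x) b)
    (fun {x y} hx a b => by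
      have := hx a (y * b)
      rwa [show a * (x * y) * b = a * x * (y * b) by simp only [mul_assoc]])
  have hwI : w ∈ I := (TwoSidedIdeal.mem_mk' ..).2 h
  have hI : I = ⊤ := by
    rcases eq_bot_or_eq_top I with hb | ht
    · rw [hb, TwoSidedIdeal.mem_bot] at hwI
      exact absurd hwI hw
    · exact ht
  have hx : x ∈ I := by rw [hI]; trivial
  have := (TwoSidedIdeal.mem_mk' ..).1 hx 1 1
  simpa using this

/-- A simple ring is prime. -/
theorem IsSimpleRing.eq_zero_of_mul_mul_eq_zero {a b : A} (ha : a ≠ 0)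
    (h : ∀ x, a * x * b = 0) : b = 0 := by
  let S : AddSubgroup A :=
    { carrier := {x | ∀ y, x * y * b = 0}
      zero_mem' := fun y => by simp
      add_mem' := fun {x x'} hx hx' y => by rw [add_mul, add_mul, hx, hx', add_zero]
      neg_mem' := fun {x} hx y => by rw [neg_mul, neg_mul, hx, neg_zero] }
  have h1 : (1 : A) ∈ S := S.mem_of_mul_mul_mem ha (fun p q y => by
    rw [show p * a * q * y * b = p * (a * (q * y) * b) by simp only [mul_assoc], h, mul_zero]) 1
  simpa using h1 1

/-- An inner derivation of square zero on a simple ring without `2`-torsion vanishes. -/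
theorem IsSimpleRing.commute_of_inner_sq_eq_zero [IsAddTorsionFree A] {u : A}
    (h : ∀ a, u * (u * a - a * u) - (u * a - a * u) * u = 0) (a : A) : u * a - a * u = 0 := by
  -- For `D = [u, ·]`, Leibniz gives `D²(ab) = D²(a) b + 2 D(a) D(b) + a D²(b)`.
  have hprod : ∀ a b, (u * a - a * u) * (u * b - b * u) = 0 := fun a b => by
    have h2 : (2 : ℕ) • ((u * a - a * u) * (u * b - b * u)) = 0 := by
      have e : (2 : ℕ) • ((u * a - a * u) * (u * b - b * u)) =
          (u * (u * (a * b) - (a * b) * u) - (u * (a * b) - (a * b) * u) * u)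
          - (u * (u * a - a * u) - (u * a - a * u) * u) * b
          - a * (u * (u * b - b * u) - (u * b - b * u) * u) := by
        noncomm_ring
      rw [e, h, h, h]; simp
    exact (smul_eq_zero.1 h2).resolve_left two_ne_zero
  by_contra hne
  refine hne (IsSimpleRing.eq_zero_of_mul_mul_eq_zero hne fun b => ?_)
  have e : (u * a - a * u) * b * (u * a - a * u) =
      (u * a - a * u) * (u * (b * a) - (b * a) * u)
      - (u * a - a * u) * (u * b - b * u) * a := by
    noncomm_ring
  rw [e, hprod, hprod]; simp

/-- Herstein: in a simple ring without `2`-torsion, a Lie ideal is central or contains all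
commutators. -/
theorem IsSimpleRing.lieIdeal_central_or_commutator_mem [IsAddTorsionFree A] (U : AddSubgroup A)
    (hU : ∀ a, ∀ u ∈ U, a * u - u * a ∈ U) :
    (∀ u ∈ U, ∀ a, u * a - a * u = 0) ∨ ∀ a b : A, a * b - b * a ∈ U := by
  have hU' : ∀ u ∈ U, ∀ a, u * a - a * u ∈ U := fun u hu a => by
    rw [← neg_sub]; exact U.neg_mem (hU a u hu)
  by_cases hcomm : ∀ x y, (∀ a, x * a - a * x ∈ U) → (∀ a, y * a - a * y ∈ U) → x * y - y * x = 0
  · left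
    intro u hu
    refine IsSimpleRing.commute_of_inner_sq_eq_zero fun a => ?_
    exact hcomm _ _ (hU' u hu) (hU' _ (hU' u hu a))
  · right
    push Not at hcomm
    obtain ⟨x, y, hx, hy, hxy⟩ := hcomm
    -- `S` is a subring containing `U`, and it absorbs multiplication of the nonzero commutator `[x,
    -- y]` on both sides, so it is all of `A`.
    let S : AddSubgroup A :=
      { carrier := {x | ∀ a, x * a - a * x ∈ U}
        zero_mem' := fun a => by simp [U.zero_mem]
        add_mem' := fun {x x'} hx hx' a => by
          rw [show (x + x') * a - a * (x + x') = (x * a - a * x) + (x' * a - a * x') by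
            noncomm_ring]
          exact U.add_mem (hx a) (hx' a)
        neg_mem' := fun {x} hx a => by
          rw [show -x * a - a * -x = -(x * a - a * x) by noncomm_ring]
          exact U.neg_mem (hx a) }
    have hSU : ∀ {u}, u ∈ U → u ∈ S := fun hu => hU' _ hu
    have hSmul : ∀ {p q}, p ∈ S → q ∈ S → p * q ∈ S := fun {p q} hp hq a => by
      rw [show p * q * a - a * (p * q) = (p * (q * a) - (q * a) * p) + (q * (a * p) - (a * p) * q)
        by noncomm_ring]
      exact U.add_mem (hp _) (hq _)
    have hSlie : ∀ {p} a, p ∈ S → p * a - a * p ∈ S := fun a hp => hSU (hp a)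
    have hr : ∀ a, (x * y - y * x) * a ∈ S := fun a => by
      rw [show (x * y - y * x) * a = (x * (y * a) - (y * a) * x) - y * (x * a - a * x) by
        noncomm_ring]
      exact S.sub_mem (hSlie _ hx) (hSmul hy (hSlie _ hx))
    have hlr : ∀ b a, b * (x * y - y * x) * a ∈ S := fun b a => by
      rw [show b * (x * y - y * x) * a = (x * y - y * x) * (a * b)
        - ((x * y - y * x) * a * b - b * ((x * y - y * x) * a)) by noncomm_ring]
      exact S.sub_mem (hr _) (hSlie _ (hr a))
    exact fun a => S.mem_of_mul_mul_mem hxy hlr a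

/-- In a noncommutative simple ring, a map `f` with `[f x, y] = [x, f y]` is, up to central values,
multiplication by a central element. -/
theorem IsSimpleRing.exists_central_of_commutator_eq {w : A × A}
    (hw : w.1 * w.2 - w.2 * w.1 ≠ 0) (f : A → A)
    (hf : ∀ x y, f x * y - y * f x = x * f y - f y * x) :
    ∃ c : A, (∀ z, c * z = z * c) ∧
      ∀ x y, (f x - c * x) * y = y * (f x - c * x) := by
  obtain ⟨u, v⟩ := w
  set B : A → A → A := fun x y => f x * y - y * f x with hB
  have hBr : ∀ x y z, B x (y * z) = B x y * z + y * B x z := fun x y z => by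
    simp only [hB]; noncomm_ring
  have hBl : ∀ x y z, B (x * y) z = B x z * y + x * B y z := fun x y z => by
    simp only [hB, hf]; noncomm_ring
  have hBz : ∀ x y z u v, B x y * z * (u * v - v * u) = (x * y - y * x) * z * B u v := by
    -- `B` is a derivation in each argument; expand `B (x * u) (y * v)` in both orders and compare.
    have key : ∀ x y u v, B x y * (u * v - v * u) = (x * y - y * x) * B u v := fun x y u v => by
      have e₁ : B (x * u) (y * v) =
          (B x y * u + x * B u y) * v + y * (B x v * u + x * B u v) := by rw [hBr, hBl, hBl]
      have e₂ : B (x * u) (y * v) =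
          (B x y * v + y * B x v) * u + x * (B u y * v + y * B u v) := by rw [hBl, hBr, hBr]
      rw [← sub_eq_zero, ← sub_eq_zero.2 (e₁.symm.trans e₂)]
      noncomm_ring
    intro x y z u v
    have h1 := key x y (z * u) v
    rw [hBl] at h1
    have h2 := key x y z v
    have e1 : B x y * (z * u * v - v * (z * u)) =
        B x y * z * (u * v - v * u) + B x y * (z * v - v * z) * u := by noncomm_ring
    rw [e1, h2, mul_add, ← mul_assoc, ← mul_assoc, add_comm] at h1
    exact add_left_cancel h1
  -- `hBz` puts the ideal generated by `[u, v]` in `S`; that `1` lies in `S` means `B x y = [x, y] *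
  -- c` for one fixed `c`.
  let S : AddSubgroup A :=
    { carrier := {c | ∃ l, ∀ x y, B x y * c = (x * y - y * x) * l}
      zero_mem' := ⟨0, by simp⟩
      add_mem' := by
        rintro a b ⟨l, hl⟩ ⟨m, hm⟩
        exact ⟨l + m, fun x y => by rw [mul_add, mul_add, hl, hm]⟩
      neg_mem' := by
        rintro a ⟨l, hl⟩
        exact ⟨-l, fun x y => by rw [mul_neg, mul_neg, hl]⟩ }
  obtain ⟨c, hc⟩ : (1 : A) ∈ S := S.mem_of_mul_mul_mem hw (fun p q => ⟨p * B u v * q, fun x y => by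
    simp only [← mul_assoc]; rw [hBz]⟩) 1
  simp only [mul_one] at hc
  have hfaith : ∀ d : A, (∀ x y, (x * y - y * x) * d = 0) → d = 0 := fun d hd =>
    IsSimpleRing.eq_zero_of_mul_mul_eq_zero hw fun z => by
      rw [show (u * v - v * u) * z * d = ((u * z) * v - v * (u * z)) * d
        - u * ((z * v - v * z) * d) by noncomm_ring, hd, hd, mul_zero, sub_zero]
  have hcz : ∀ z u v, c * z * (u * v - v * u) = z * (u * v - v * u) * c := fun z u v => by
    refine sub_eq_zero.1 (hfaith _ fun x y => ?_)
    have h := hBz x y z u v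
    rw [hc, hc] at h
    rw [mul_sub, sub_eq_zero]
    simpa only [mul_assoc] using h
  have hcentral : ∀ z, c * z = z * c := fun z => by
    have h0 : ∀ t, (c * z - z * c) * t * (u * v - v * u) = 0 := fun t => by
      have h1 := hcz (z * t) u v
      have h2 := hcz t u v
      rw [show (c * z - z * c) * t * (u * v - v * u) =
        c * (z * t) * (u * v - v * u) - z * (c * t * (u * v - v * u)) by noncomm_ring, h1, h2]
      noncomm_ring
    by_contra hne
    exact hw (IsSimpleRing.eq_zero_of_mul_mul_eq_zero (sub_ne_zero.2 hne) h0)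
  refine ⟨c, hcentral, fun x y => ?_⟩
  have h := hc x y
  rw [← hcentral] at h
  rw [← sub_eq_zero, show (f x - c * x) * y - y * (f x - c * x) =
    B x y - c * (x * y - y * x) - (c * y - y * c) * x by simp only [hB]; noncomm_ring, h,
    hcentral y]
  simp

end SimpleRing

/-! ### The trace form, the splitting into scalars and commutators, and the commutant -/

section CentralSimple

variable {F A : Type*} [Field F] [Ring A] [Algebra F A]

theorem commutator_mem_commutatorSubspace (x y : A) :
    x * y - y * x ∈ commutatorSubspace F A :=
  Submodule.subset_span ⟨x, y, rfl⟩

theorem commutatorSubspace_le {W : Submodule F A} (h : ∀ x y : A, x * y - y * x ∈ W) :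
    commutatorSubspace F A ≤ W :=
  Submodule.span_le.2 (by rintro _ ⟨x, y, rfl⟩; exact h x y)

/-- The trace of left multiplication. -/
noncomputable def mulLeftTrace (F A : Type*) [Field F] [Ring A] [Algebra F A] : A →ₗ[F] F :=
  LinearMap.trace F A ∘ₗ (Algebra.lmul F A).toLinearMap

theorem mulLeftTrace_mul_comm (x y : A) :
    mulLeftTrace F A (x * y) = mulLeftTrace F A (y * x) := by
  simp only [mulLeftTrace, LinearMap.comp_apply, AlgHom.toLinearMap_apply, map_mul]
  exact LinearMap.trace_mul_comm F _ _

theorem mulLeftTrace_one [FiniteDimensional F A] : mulLeftTrace F A 1 = Module.finrank F A := by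
  simp only [mulLeftTrace, LinearMap.comp_apply, AlgHom.toLinearMap_apply, map_one]
  exact LinearMap.trace_one F A

theorem mulLeftTrace_eq_zero_of_mem {x : A} (hx : x ∈ commutatorSubspace F A) :
    mulLeftTrace F A x = 0 := by
  have : commutatorSubspace F A ≤ LinearMap.ker (mulLeftTrace F A) :=
    commutatorSubspace_le fun x y => by
      rw [LinearMap.mem_ker, map_sub, mulLeftTrace_mul_comm, sub_self]
  exact this hx

theorem exists_algebraMap_eq_of_commute [Algebra.IsCentral F A] {x : A}
    (h : ∀ y, x * y = y * x) : ∃ r : F, x = algebraMap F A r :=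
  (Algebra.IsCentral.mem_center_iff F).1 (Subalgebra.mem_center_iff.2 fun y => (h y).symm)

variable [CharZero F] [FiniteDimensional F A] [IsSimpleRing A]

theorem mulLeftTrace_one_ne_zero : mulLeftTrace F A 1 ≠ 0 := by
  rw [mulLeftTrace_one]
  exact_mod_cast Module.finrank_pos.ne'

theorem eq_zero_of_algebraMap_mem_commutatorSubspace {r : F}
    (h : algebraMap F A r ∈ commutatorSubspace F A) : r = 0 := by
  have := mulLeftTrace_eq_zero_of_mem h
  rw [Algebra.algebraMap_eq_smul_one, map_smul, smul_eq_mul] at this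
  exact (mul_eq_zero.1 this).resolve_right mulLeftTrace_one_ne_zero

/-- The trace form of a finite-dimensional simple algebra is nondegenerate. -/
theorem eq_zero_of_mulLeftTrace_mul_eq_zero {c : A}
    (h : ∀ x, mulLeftTrace F A (c * x) = 0) : c = 0 := by
  by_contra hc
  refine mulLeftTrace_one_ne_zero (F := F) (A := A) ?_
  exact (LinearMap.ker (mulLeftTrace F A)).toAddSubgroup.mem_of_mul_mul_mem hc (fun a b => by
    change mulLeftTrace F A (a * c * b) = 0
    rw [mul_assoc, mulLeftTrace_mul_comm, mul_assoc, h]) 1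

variable [Algebra.IsCentral F A]

/-- A functional killing the left side is `x ↦ tr(c x)` by nondegeneracy. Vanishing on commutators
makes `c` central, hence scalar, and vanishing at `1` makes it zero. -/
theorem span_one_sup_commutatorSubspace :
    Submodule.span F {(1 : A)} ⊔ commutatorSubspace F A = ⊤ := by
  by_contra hne
  obtain ⟨f, hf, hle⟩ := Submodule.exists_le_ker_of_lt_top _ (lt_top_iff_ne_top.2 hne)
  rw [sup_le_iff] at hle
  have hf1 : f 1 = 0 := hle.1 (Submodule.mem_span_singleton_self _)
  have hfL : ∀ x y, f (x * y) = f (y * x) := fun x y => by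
    rw [← sub_eq_zero, ← map_sub]; exact hle.2 (commutator_mem_commutatorSubspace x y)
  let Φ : A →ₗ[F] Module.Dual F A := (LinearMap.mul F A).compr₂ (mulLeftTrace F A)
  have hΦ : ∀ c x, Φ c x = mulLeftTrace F A (c * x) := fun _ _ => rfl
  have hinj : Function.Injective Φ := by
    rw [← LinearMap.ker_eq_bot, LinearMap.ker_eq_bot']
    exact fun c hc => eq_zero_of_mulLeftTrace_mul_eq_zero (F := F) fun x => by
      rw [← hΦ, hc, LinearMap.zero_apply]
  obtain ⟨c, rfl⟩ := (LinearMap.injective_iff_surjective_of_finrank_eq_finrank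
    (Subspace.dual_finrank_eq (K := F) (V := A)).symm).1 hinj f
  obtain ⟨r, rfl⟩ : ∃ r : F, c = algebraMap F A r := exists_algebraMap_eq_of_commute fun y => by
    refine sub_eq_zero.1 (eq_zero_of_mulLeftTrace_mul_eq_zero (F := F) fun x => ?_)
    have := hfL y x
    rw [hΦ, hΦ] at this
    rw [sub_mul, map_sub, mul_assoc, this, mul_assoc y, mulLeftTrace_mul_comm y, mul_assoc,
      sub_self]
  rw [hΦ, mul_one, Algebra.algebraMap_eq_smul_one, map_smul, smul_eq_mul] at hf1
  rw [(mul_eq_zero.1 hf1).resolve_right mulLeftTrace_one_ne_zero] at hf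
  simp at hf

theorem exists_algebraMap_add (x : A) :
    ∃ r : F, ∃ y ∈ commutatorSubspace F A, x = algebraMap F A r + y := by
  have hx : x ∈ Submodule.span F {(1 : A)} ⊔ commutatorSubspace F A := by
    rw [span_one_sup_commutatorSubspace]; trivial
  obtain ⟨s, hs, y, hy, rfl⟩ := Submodule.mem_sup.1 hx
  obtain ⟨r, rfl⟩ := Submodule.mem_span_singleton.1 hs
  exact ⟨r, y, hy, by rw [Algebra.algebraMap_eq_smul_one]⟩

/-- Linear endomorphisms of `A` commuting with all inner derivations are, up to central values,
scalar. -/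
theorem exists_smul_add_of_commute_inner {f : A →ₗ[F] A}
    (hf : ∀ a x, f (a * x - x * a) = a * f x - f x * a) :
    ∃ (c : F) (g : A → F), (∀ x, f x = c • x + algebraMap F A (g x)) ∧
      ∀ x ∈ commutatorSubspace F A, g x = 0 := by
  have hfL : ∀ x ∈ commutatorSubspace F A, f x ∈ commutatorSubspace F A := fun x hx => by
    have : commutatorSubspace F A ≤ (commutatorSubspace F A).comap f :=
      commutatorSubspace_le fun x y => by
        rw [Submodule.mem_comap, hf]; exact commutator_mem_commutatorSubspace _ _
    exact this hx
  have hfs : ∀ x y, f x * y - y * f x = x * f y - f y * x := fun x y => by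
    rw [← neg_sub, ← hf, ← hf, ← map_neg, neg_sub]
  obtain ⟨c, hc⟩ : ∃ c : F, ∀ x y, (f x - c • x) * y = y * (f x - c • x) := by
    by_cases hw : ∃ w : A × A, w.1 * w.2 - w.2 * w.1 ≠ 0
    · obtain ⟨w, hw⟩ := hw
      obtain ⟨c, hc, h⟩ := IsSimpleRing.exists_central_of_commutator_eq hw f hfs
      obtain ⟨r, rfl⟩ := exists_algebraMap_eq_of_commute (F := F) hc
      exact ⟨r, fun x y => by simpa only [Algebra.smul_def] using h x y⟩
    · push Not at hw
      exact ⟨0, fun x y => sub_eq_zero.1 (hw (f x - (0 : F) • x, y))⟩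
  choose g hg using fun x => exists_algebraMap_eq_of_commute (F := F) (hc x)
  refine ⟨c, g, fun x => by rw [← hg, add_sub_cancel], fun x hx => ?_⟩
  refine eq_zero_of_algebraMap_mem_commutatorSubspace (A := A) ?_
  rw [← hg]
  exact Submodule.sub_mem _ (hfL x hx) (Submodule.smul_mem _ _ hx)

end CentralSimple

/-! ### From (i) to (ii) and from (ii) to (iii) -/

section MultiplicationSums

variable {F A : Type*} [Field F] [Ring A] [Algebra F A]

theorem exists_mul_sum_of_mem_innerDerivationAlgebra {T : Module.End F A}
    (hT : T ∈ innerDerivationAlgebra F A) :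
    ∃ (n : ℕ) (a b : Fin n → A), (∀ x : A, T x = ∑ k, a k * x * b k) ∧
      ∑ k, a k * b k = 0 ∧ ∑ k, b k * a k = 0 := by
  unfold innerDerivationAlgebra at hT
  induction hT using NonUnitalAlgebra.adjoin_induction with
  | mem T hT =>
    obtain ⟨a, rfl⟩ := hT
    exact ⟨2, ![a, -1], ![1, a], by simp [sub_eq_add_neg], by simp, by simp⟩
  | add S T _ _ hS hT =>
    obtain ⟨n, a, b, h, h1, h2⟩ := hS
    obtain ⟨m, c, d, h', h1', h2'⟩ := hT
    refine ⟨n + m, Fin.append a c, Fin.append b d, fun x => ?_, ?_, ?_⟩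
    · simp [Fin.sum_univ_add, h, h']
    · simp [Fin.sum_univ_add, h1, h1']
    · simp [Fin.sum_univ_add, h2, h2']
  | zero => exact ⟨0, ![], ![], by simp, by simp, by simp⟩
  | mul S T _ _ hS hT =>
    obtain ⟨n, a, b, h, h1, h2⟩ := hS
    obtain ⟨m, c, d, h', h1', h2'⟩ := hT
    refine ⟨n * m, fun k => a (finProdFinEquiv.symm k).1 * c (finProdFinEquiv.symm k).2,
      fun k => d (finProdFinEquiv.symm k).2 * b (finProdFinEquiv.symm k).1, fun x => ?_, ?_, ?_⟩
    · rw [finProdFinEquiv.symm.sum_comp (fun p => a p.1 * c p.2 * x * (d p.2 * b p.1)),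
        Fintype.sum_prod_type, Module.End.mul_apply, h, h']
      simp only [Finset.mul_sum, Finset.sum_mul, mul_assoc]
    · rw [finProdFinEquiv.symm.sum_comp (fun p => a p.1 * c p.2 * (d p.2 * b p.1)),
        Fintype.sum_prod_type]
      refine Finset.sum_eq_zero fun i _ => ?_
      have : ∑ j, a i * c j * (d j * b i) = a i * (∑ j, c j * d j) * b i := by
        simp only [Finset.mul_sum, Finset.sum_mul, mul_assoc]
      rw [this, h1', mul_zero, zero_mul]
    · rw [finProdFinEquiv.symm.sum_comp (fun p => d p.2 * b p.1 * (a p.1 * c p.2)),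
        -- In the reversed products the factors of `S` are innermost, so the sum over `i` must be
        -- taken first.
        Fintype.sum_prod_type_right]
      refine Finset.sum_eq_zero fun j _ => ?_
      have : ∑ i, d j * b i * (a i * c j) = d j * (∑ i, b i * a i) * c j := by
        simp only [Finset.mul_sum, Finset.sum_mul, mul_assoc]
      rw [this, h2, mul_zero, zero_mul]
  | smul r T _ hT =>
    obtain ⟨n, a, b, h, h1, h2⟩ := hT
    refine ⟨n, fun k => r • a k, b, fun x => ?_, ?_, ?_⟩
    · simp [h, Finset.smul_sum]
    · simp [← Finset.smul_sum, h1]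
    · simp [← Finset.smul_sum, h2]

/-- Modulo commutators, `a k * x * b k` equals `b k * a k * x`, and these sum to zero. -/
theorem apply_one_and_apply_mem_of_mul_sum {T : Module.End F A} {n : ℕ} {a b : Fin n → A}
    (hT : ∀ x : A, T x = ∑ k, a k * x * b k) (hab : ∑ k, a k * b k = 0)
    (hba : ∑ k, b k * a k = 0) : T 1 = 0 ∧ ∀ x : A, T x ∈ commutatorSubspace F A := by
  refine ⟨by rw [hT]; simpa using hab, fun x => ?_⟩
  have : T x = ∑ k, (a k * x * b k - b k * (a k * x)) := by
    rw [Finset.sum_sub_distrib, hT]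
    simp only [← mul_assoc]
    rw [← Finset.sum_mul, hba, zero_mul, sub_zero]
  rw [this]
  exact Submodule.sum_mem _ fun k _ => commutator_mem_commutatorSubspace _ _

end MultiplicationSums

/-! ### Semisimplicity and density -/

section InnerDerivationAlgebra

variable {F A : Type*} [Field F] [Ring A] [Algebra F A]

theorem inner_mem_innerDerivationAlgebra (a : A) :
    LinearMap.mulLeft F a - LinearMap.mulRight F a ∈ innerDerivationAlgebra F A :=
  NonUnitalAlgebra.subset_adjoin F ⟨a, rfl⟩

theorem apply_mem_of_mem_innerDerivationAlgebra {W : Submodule F A}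
    (hW : ∀ a, ∀ x ∈ W, a * x - x * a ∈ W) {T : Module.End F A}
    (hT : T ∈ innerDerivationAlgebra F A) : ∀ x ∈ W, T x ∈ W := by
  unfold innerDerivationAlgebra at hT
  induction hT using NonUnitalAlgebra.adjoin_induction with
  | mem T hT => obtain ⟨a, rfl⟩ := hT; exact hW a
  | add S T _ _ hS hT => exact fun x hx => W.add_mem (hS x hx) (hT x hx)
  | zero => exact fun x _ => W.zero_mem
  | mul S T _ _ hS hT => exact fun x hx => hS _ (hT x hx)
  | smul r T _ hT => exact fun x hx => W.smul_mem r (hT x hx)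

/-- The unital algebra generated by the inner derivations. -/
abbrev unitalInnerDerivationAlgebra (F A : Type*) [Field F] [Ring A] [Algebra F A] :
    Subalgebra F (Module.End F A) :=
  (NonUnitalSubalgebra.unitization (innerDerivationAlgebra F A)).range

theorem mem_unitalInnerDerivationAlgebra {T : Module.End F A} :
    T ∈ unitalInnerDerivationAlgebra F A ↔
      ∃ r : F, ∃ S ∈ innerDerivationAlgebra F A, T = algebraMap F _ r + S := by
  constructor
  · rintro ⟨u, rfl⟩
    exact ⟨u.fst, u.snd, u.snd.2, rfl⟩
  · rintro ⟨r, S, hS, rfl⟩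
    exact ⟨Unitization.inl r + Unitization.inr ⟨S, hS⟩, by simp⟩

theorem inner_mem_unitalInnerDerivationAlgebra (a : A) :
    LinearMap.mulLeft F a - LinearMap.mulRight F a ∈ unitalInnerDerivationAlgebra F A :=
  mem_unitalInnerDerivationAlgebra.2
    ⟨0, _, inner_mem_innerDerivationAlgebra a, by rw [map_zero, zero_add]⟩

/-- A subspace stable under commutators, as a submodule over the algebra generated by the inner
derivations. -/
def Submodule.ofInnerStable (W : Submodule F A) (hW : ∀ a, ∀ x ∈ W, a * x - x * a ∈ W) :
    Submodule (unitalInnerDerivationAlgebra F A) A :=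
  { W.toAddSubmonoid with
    smul_mem' := by
      rintro ⟨T, hT⟩ x hx
      obtain ⟨r, S, hS, rfl⟩ := mem_unitalInnerDerivationAlgebra.1 hT
      exact W.add_mem (W.smul_mem r hx) (apply_mem_of_mem_innerDerivationAlgebra hW hS x hx) }

theorem Submodule.inner_mem (U : Submodule (unitalInnerDerivationAlgebra F A) A) (a : A)
    {x : A} (hx : x ∈ U) : a * x - x * a ∈ U :=
  U.smul_mem ⟨_, inner_mem_unitalInnerDerivationAlgebra a⟩ hx

variable [CharZero F] [FiniteDimensional F A] [IsSimpleRing A] [Algebra.IsCentral F A]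

theorem isSemisimpleModule_unitalInnerDerivationAlgebra :
    IsSemisimpleModule (unitalInnerDerivationAlgebra F A) A := by
  let L := (commutatorSubspace F A).ofInnerStable
    fun a x _ => commutator_mem_commutatorSubspace a x
  let Z := (Submodule.span F {(1 : A)}).ofInnerStable fun a x hx => by
    obtain ⟨r, rfl⟩ := Submodule.mem_span_singleton.1 hx
    simp
  have hmemZ : ∀ {x : A}, x ∈ Z ↔ ∃ r : F, x = algebraMap F A r := fun {x} => by
    refine Submodule.mem_span_singleton.trans (exists_congr fun r => ?_)
    rw [Algebra.algebraMap_eq_smul_one, eq_comm]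
  have hsmul : ∀ (U : Submodule (unitalInnerDerivationAlgebra F A) A) (r : F) {x : A},
      x ∈ U → r • x ∈ U := fun U r x hx => (U.restrictScalars F).smul_mem r hx
  have hZL : IsCompl Z L := by
    refine IsCompl.of_eq (eq_bot_iff.2 fun x hx => ?_) (eq_top_iff.2 fun x _ => ?_)
    · obtain ⟨r, rfl⟩ := hmemZ.1 hx.1
      rw [eq_zero_of_algebraMap_mem_commutatorSubspace hx.2]
      simp
    · obtain ⟨r, y, hy, rfl⟩ := exists_algebraMap_add (F := F) x
      exact Submodule.add_mem_sup (hmemZ.2 ⟨r, rfl⟩) hy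
  have hZ : ∀ U : Submodule (unitalInnerDerivationAlgebra F A) A, U ≤ Z → U ≠ ⊥ → U = Z := by
    intro U hUZ hU
    obtain ⟨x, hx, hx0⟩ := U.ne_bot_iff.1 hU
    obtain ⟨r, rfl⟩ := hmemZ.1 (hUZ hx)
    have hr : r ≠ 0 := by rintro rfl; simp at hx0
    refine le_antisymm hUZ fun y hy => ?_
    obtain ⟨s, rfl⟩ := hmemZ.1 hy
    have := hsmul U (s * r⁻¹) hx
    rwa [Algebra.smul_def, ← map_mul, inv_mul_cancel_right₀ hr] at this
  refine (isSemisimpleModule_iff _ _).2 ⟨fun U => ?_⟩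
  have : IsAddTorsionFree A := by
    let _ : Module ℚ A := Module.compHom A (algebraMap ℚ F)
    exact IsAddTorsionFree.of_module_rat A
  -- Either `U` lies in the line `Z`, so is `⊥` or `Z`, or it contains `L`, so is `L` or `⊤`.
  rcases IsSimpleRing.lieIdeal_central_or_commutator_mem (U.restrictScalars F).toAddSubgroup
    (fun a u hu => Submodule.inner_mem U a hu) with h | h
  · have hUZ : U ≤ Z := fun u hu =>
      hmemZ.2 (exists_algebraMap_eq_of_commute fun a => sub_eq_zero.1 (h u hu a))
    by_cases hU : U = ⊥
    · exact ⟨⊤, hU ▸ isCompl_bot_top⟩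
    · exact ⟨L, hZ U hUZ hU ▸ hZL⟩
  · have hLU : L ≤ U := fun x hx =>
      (commutatorSubspace_le (W := U.restrictScalars F) h) hx
    by_cases hUZ : U ⊓ Z = ⊥
    · refine ⟨Z, ⟨disjoint_iff.2 hUZ, ?_⟩⟩
      exact (hZL.symm.codisjoint).mono_left hLU
    · have hZU : Z ≤ U := inf_eq_right.1 (hZ _ inf_le_right hUZ)
      have : U = ⊤ := eq_top_iff.2 (hZL.sup_eq_top ▸ sup_le hZU hLU)
      exact ⟨⊥, this ▸ isCompl_top_bot⟩

theorem mem_innerDerivationAlgebra_of_apply_mem {T : Module.End F A} (h1 : T 1 = 0)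
    (hT : ∀ x, T x ∈ commutatorSubspace F A) : T ∈ innerDerivationAlgebra F A := by
  have := isSemisimpleModule_unitalInnerDerivationAlgebra (F := F) (A := A)
  have hcomm : ∀ (φ : Module.End (unitalInnerDerivationAlgebra F A) A) x, T (φ x) = φ (T x) := by
    intro φ x
    obtain ⟨c, g, hφ, hg⟩ := exists_smul_add_of_commute_inner
      (f := φ.restrictScalars F) fun a x =>
        φ.map_smul ⟨_, inner_mem_unitalInnerDerivationAlgebra a⟩ x
    simp only [LinearMap.restrictScalars_apply] at hφ
    rw [hφ, hφ, hg _ (hT x), Algebra.algebraMap_eq_smul_one]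
    simp [h1]
  let f : Module.End (Module.End (unitalInnerDerivationAlgebra F A) A) A :=
    { toFun := T
      map_add' := map_add T
      map_smul' := hcomm }
  -- Density gives agreement on a finite set only; a spanning set suffices.
  obtain ⟨s, hs⟩ := (Module.Finite.fg_top (R := F) (M := A))
  obtain ⟨⟨R, hR⟩, hTR⟩ := jacobson_density (R := unitalInnerDerivationAlgebra F A) f s
  have hTR' : T = R := LinearMap.ext_on hs fun x hx => hTR x hx
  obtain ⟨r, S, hS, rfl⟩ := mem_unitalInnerDerivationAlgebra.1 hR
  obtain ⟨n, a, b, hS', hab, hba⟩ := exists_mul_sum_of_mem_innerDerivationAlgebra hS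
  have hS1 : S 1 = 0 := (apply_one_and_apply_mem_of_mul_sum hS' hab hba).1
  have hr : r = 0 := by
    rw [hTR', LinearMap.add_apply, hS1, add_zero, Module.algebraMap_end_apply] at h1
    exact (smul_eq_zero.1 h1).resolve_right one_ne_zero
  rw [hTR', hr, map_zero, zero_add]
  exact hS

end InnerDerivationAlgebra

theorem corollary3p6 {F A : Type*} [Field F] [CharZero F] [Ring A] [Algebra F A]
    [FiniteDimensional F A] [Algebra.IsCentral F A] [IsSimpleRing A] (T : Module.End F A) :
    List.TFAE
      [T ∈ innerDerivationAlgebra F A,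
       ∃ (n : ℕ) (a b : Fin n → A), (∀ x : A, T x = ∑ k, a k * x * b k) ∧
         ∑ k, a k * b k = 0 ∧ ∑ k, b k * a k = 0,
       T 1 = 0 ∧ ∀ x : A, T x ∈ commutatorSubspace F A] := by
  tfae_have 1 → 2 := exists_mul_sum_of_mem_innerDerivationAlgebra
  tfae_have 2 → 3 := by
    rintro ⟨n, a, b, hT, hab, hba⟩
    exact apply_one_and_apply_mem_of_mul_sum hT hab hba
  tfae_have 3 → 1 := fun h => mem_innerDerivationAlgebra_of_apply_mem h.1 h.2
  tfae_finish
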